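/- Let $\Psi\in\mathbb R^{d\times K}$ be a dictionary with columns (atoms) $\psi_1,\dots,\psi_K$ normalised so that $\|\psi_k\|_2\le 1$ (for instance, of unit norm). Let $x\in\mathbb R^K$ have support $\Lambda=\{i: x_i\neq 0\}$, let $y=\Psi x$ with $\|y\|_2=1$, and suppose that the support is recoverable by thresholding with a margin $\varepsilon>0$, i.e. $$\min_{i\in\Lambda}|\langle y,\psi_i\rangle|>\max_{k\notin\Lambda}|\langle y,\psi_k\rangle|+\varepsilon$$ (the maximum over an empty index set is $0$). Put $C_1=\frac{4e}{\sqrt{6\pi}}$, $C_2=e\sqrt2$ and $C(\varepsilon)=4C_1\varepsilon^{-2}+2C_2\varepsilon^{-1}$. Let $A$ be an $n\times d$ random matrix with independent entries which either are all $N(0,1/n)$-distributed or all take the values $\pm1/\sqrt n$ with probability $1/2$ each, and let $t\in\mathbb R$. If $$n\ge C(\varepsilon)\,(\log(2K)+t),$$ then with probability exceeding $1-e^{-t}$ thresholding recovers the support, and thus the signal, from $s=Ay=A\Psi x$. That is: $\Lambda$ is the only set of $|\Lambda|$ indices $j$ on which $|\langle s,A\psi_j\rangle|$ is largest; and the output $\hat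 x$ of thresholding, which equals $(A\Psi)_\Lambda^\dagger s$ on $\Lambda$ (Moore–Penrose pseudo-inverse of the matrix of the columns of $A\Psi$ indexed by $\Lambda$) and $0$ elsewhere, satisfies $\Psi\hat x=y$ if $A$ is injective on $\operatorname{span}\{\psi_i:i\in\Lambda\}$, and $\hat x=x$ if the vectors $A\psi_i$, $i\in\Lambda$, are linearly independent. Moreover $C(\varepsilon)\le(4C_1+2C_2)\,\varepsilon^{-2}$ and $4C_1+2C_2\le 17.71$. -/

import Mathlib

open MeasureTheory ProbabilityTheory
open scoped Matrix NNReal ENNReal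

namespace Thresholding

noncomputable section

/-- The Euclidean norm of a coordinate vector. -/
def l2norm {m : ℕ} (v : Fin m → ℝ) : ℝ := ‖WithLp.toLp 2 v‖

/-- The support of a coefficient vector. -/
def supp {K : ℕ} (x : Fin K → ℝ) : Finset (Fin K) := {i | x i ≠ 0}

/-- A dictionary: a matrix whose columns (the atoms) are normalised, in the weak sense that
their Euclidean norm is at most one. -/
def IsDictionary {d K : ℕ} (Ψ : Matrix (Fin d) (Fin K) ℝ) : Prop :=
  ∀ k, l2norm (Ψ.col k) ≤ 1

/-- `min_{i ∈ Λ} |⟨y, ψ_i⟩| > max_{k ∉ Λ} |⟨y, ψ_k⟩| + ε`. If every index lies in `Λ`, the maximum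
of the empty family of absolute values is `0`. (If `Λ` is empty, the statement is false for
`ε > 0`.) -/
def HasMargin {d K : ℕ} (Ψ : Matrix (Fin d) (Fin K) ℝ) (y : Fin d → ℝ)
    (Λ : Finset (Fin K)) (ε : ℝ) : Prop :=
  (⨆ k : {k // k ∉ Λ}, |y ⬝ᵥ Ψ.col k|) + ε < ⨅ i : {i // i ∈ Λ}, |y ⬝ᵥ Ψ.col i|

/-- `Λ` is an index set that thresholding with sparsity level `S` may select from the data `s`:
it holds the indices of `S` largest values of `|⟨s, φ_j⟩|`, where `φ_j` are the columns of `Φ`.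
(Several sets qualify only if there are ties.) -/
def IsSelection {n K : ℕ} (Φ : Matrix (Fin n) (Fin K) ℝ) (s : Fin n → ℝ) (S : ℕ)
    (Λ : Finset (Fin K)) : Prop :=
  Λ.card = S ∧ ∀ i ∈ Λ, ∀ j ∉ Λ, |s ⬝ᵥ Φ.col j| ≤ |s ⬝ᵥ Φ.col i|

/-- The Moore-Penrose pseudo-inverse of a linear map `T`: project orthogonally onto the range
of `T`, then invert `T` on the orthogonal complement of its kernel. -/
def pinv {E F : Type*} [NormedAddCommGroup E] [InnerProductSpace ℝ E] [FiniteDimensional ℝ E]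
    [NormedAddCommGroup F] [InnerProductSpace ℝ F] [FiniteDimensional ℝ F] (T : E →ₗ[ℝ] F) :
    F →ₗ[ℝ] E :=
  (LinearMap.ker T)ᗮ.subtype ∘ₗ
    (T.kerComplementEquivRange
      (Submodule.isCompl_orthogonal _).symm).symm.toLinearMap ∘ₗ
    (LinearMap.range T).orthogonalProjectionOnto.toLinearMap

/-- The output of thresholding once `Λ` is selected: the coefficients `Φ_Λ^† s` on `Λ`, where
`Φ_Λ` is made of the columns of `Φ` indexed by `Λ`, and zero off `Λ`. -/
def output {n K : ℕ} (Φ : Matrix (Fin n) (Fin K) ℝ) (s : Fin n → ℝ)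
    (Λ : Finset (Fin K)) : Fin K → ℝ := fun j =>
  if h : j ∈ Λ then
    pinv (Matrix.toEuclideanLin (Φ.submatrix id (fun i : {i // i ∈ Λ} => (i : Fin K))))
      (WithLp.toLp 2 s) ⟨j, h⟩
  else 0

/-- Thresholding applied to `s = A Ψ x` with sparsity level `|supp x|` recovers the support of
`x`, whatever way ties are broken, and thus the signal: the output `x̂` satisfies `Ψ x̂ = Ψ x` if
`A` is injective on the span of the atoms in the support, and `x̂ = x` if the columns of `A Ψ`
in the support are linearly independent. -/
def Recovers {n d K : ℕ} (A : Matrix (Fin n) (Fin d) ℝ) (Ψ : Matrix (Fin d) (Fin K) ℝ)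
    (x : Fin K → ℝ) : Prop :=
  (∃ Λ, IsSelection (A * Ψ) (A *ᵥ (Ψ *ᵥ x)) (supp x).card Λ) ∧
  ∀ Λ, IsSelection (A * Ψ) (A *ᵥ (Ψ *ᵥ x)) (supp x).card Λ →
    Λ = supp x ∧
    (Set.InjOn (fun v => A *ᵥ v)
        (Submodule.span ℝ (Ψ.col '' (supp x : Set (Fin K))) : Set (Fin d → ℝ)) →
      Ψ *ᵥ output (A * Ψ) (A *ᵥ (Ψ *ᵥ x)) Λ = Ψ *ᵥ x) ∧
    (LinearIndependent ℝ (fun i : {i // i ∈ supp x} => (A * Ψ).col i) →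
      output (A * Ψ) (A *ᵥ (Ψ *ᵥ x)) Λ = x)

/-- Independent entries with law `N(0, 1/n)`. -/
def IsGaussianEnsemble {Ω : Type*} [MeasurableSpace Ω] (P : Measure Ω) {n d : ℕ}
    (A : Ω → Matrix (Fin n) (Fin d) ℝ) : Prop :=
  iIndepFun (fun (p : Fin n × Fin d) ω => A ω p.1 p.2) P ∧
  ∀ i j, HasLaw (fun ω => A ω i j) (gaussianReal 0 ((n : ℝ≥0)⁻¹)) P

/-- Independent entries taking each of the values `1/√n` and `-1/√n` with probability `1/2`. -/
def IsBernoulliEnsemble {Ω : Type*} [MeasurableSpace Ω] (P : Measure Ω) {n d : ℕ}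
    (A : Ω → Matrix (Fin n) (Fin d) ℝ) : Prop :=
  iIndepFun (fun (p : Fin n × Fin d) ω => A ω p.1 p.2) P ∧
  ∀ i j, HasLaw (fun ω => A ω i j)
    ((2⁻¹ : ℝ≥0∞) • Measure.dirac (1 / √(n : ℝ)) + (2⁻¹ : ℝ≥0∞) • Measure.dirac (-(1 / √(n : ℝ)))) P

/-- `C₁ = 4e / √(6π)`. -/
def C₁ : ℝ := 4 * Real.exp 1 / √(6 * Real.pi)

/-- `C₂ = e √2`. -/
def C₂ : ℝ := Real.exp 1 * √2

/-- `C(ε) = 4 C₁ ε⁻² + 2 C₂ ε⁻¹`. -/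
def C (ε : ℝ) : ℝ := 4 * C₁ / ε ^ 2 + 2 * C₂ / ε

end

end Thresholding

/-!
Write `y = Ψ x`, a unit vector, and split each atom as `ψ_k = ρ_k y + w_k` with `ρ_k = ⟨y, ψ_k⟩`,
`w_k ⟂ y` and `‖w_k‖ ≤ 1`. Then `⟨Ay, Aψ_k⟩ = ρ_k ‖Ay‖² + ⟨Ay, Aw_k⟩`. Thresholding only compares
the correlations with each other, so that the common random factor `‖Ay‖²` is harmless: with the
margin `ε`, the support is recovered as soon as `|⟨Ay, Aw_k⟩| < (ε / 2) ‖Ay‖²` for every `k`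
(`recovers_of_deviation_lt`). Comparing `⟨Ay, Aψ_k⟩` with `ρ_k` itself would not do: its variance
can be `2 / n`, which is too large for the constant `C₁` when `ε` is small.

There are `2 K` one-sided events `(ε / 2) ‖Ay‖² ≤ ± ⟨Ay, Aw_k⟩`. By Chernoff's bound over the
independent rows, each has probability at most `exp (- n * rate ε)` (`measure_deviation_le`), where
`rate ε` comes from the exponential moment of the quadratic form
`l (⟨g, y⟩ ⟨g, w⟩ - (ε / 2) ⟨g, y⟩²)` in one row `g`, rescaled to entries of variance one. Its
matrix `M` has trace `- l ε / 2` and squared Frobenius norm at most `l² (1 / 2 + ε² / 4)`. For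
Gaussian `g` a rotation diagonalises `M`, and
`E exp ⟨g, M g⟩ = ∏ (1 - 2 μ_i) ^ (- 1 / 2)` over the eigenvalues `μ_i` is estimated by the trace
and the Frobenius norm (`lintegral_exp_quadForm_gaussian`). For signs the diagonal of `M`
contributes the constant trace; the rest is affine in each coordinate, so that replacing the signs
one by one by Gaussian variables only increases the exponential moment, since
`cosh s ≤ exp (s² / 2)`, and the same estimate holds (`lintegral_exp_quadForm_le`).

Finally `rate ε` exceeds `1 / C ε` strictly for `0 < ε ≤ 1` (`one_lt_C_mul_rate`), and the margin
condition forces `ε < 1` (`HasMargin.lt_one`). The union bound then gives the failure probability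
`2 K exp (- n * rate ε) < exp (- t)`.
-/

namespace Thresholding

/-! ### Exponential moments of quadratic forms -/

/-- The difference of the two sides has derivative `x ^ 3 / (3 * (1 - x) ^ 2)`. -/
lemma neg_log_one_sub_le_of_nonneg {x : ℝ} (hx : 0 ≤ x) (hx1 : x < 1) :
    -Real.log (1 - x) ≤ x + x ^ 2 * (3 - x) / (6 * (1 - x)) := by
  let h : ℝ → ℝ := fun x => x + x ^ 2 * (3 - x) / (6 * (1 - x)) + Real.log (1 - x)
  have hd : ∀ z ∈ Set.Ico (0 : ℝ) 1, HasDerivAt h (z ^ 3 / (3 * (1 - z) ^ 2)) z := by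
    intro z hz
    have hz1 : 1 - z ≠ 0 := by linarith [hz.2]
    have h1 : HasDerivAt (fun z : ℝ => 1 - z) (-1) z := by
      simpa using (hasDerivAt_id z).const_sub 1
    have h2 : HasDerivAt (fun z : ℝ => z ^ 2 * (3 - z)) (6 * z - 3 * z ^ 2) z := by
      have := ((hasDerivAt_id z).pow 2).mul ((hasDerivAt_id z).const_sub 3)
      refine this.congr_deriv ?_
      simp
      ring
    have := ((hasDerivAt_id z).add (h2.div (h1.const_mul 6) (by simpa using hz1))).add
      (h1.log hz1)
    refine this.congr_deriv ?_
    field_simp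
    ring
  have hmono : MonotoneOn h (Set.Ico 0 1) := by
    refine monotoneOn_of_deriv_nonneg (convex_Ico 0 1)
      (fun z hz => (hd z hz).continuousAt.continuousWithinAt) ?_ ?_
    · intro z hz
      exact (hd z (interior_subset hz)).differentiableAt.differentiableWithinAt
    · intro z hz
      have hz' := interior_subset hz
      rw [(hd z hz').deriv]
      have := hz'.1
      positivity
  have := hmono (Set.left_mem_Ico.2 one_pos) ⟨hx, hx1⟩ hx
  simp only [h] at this
  norm_num at this
  linarith

/-- A bound for `-log (1 - x) - x` by a multiple of `x ^ 2` that is uniform on `[-S, S]`. -/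
lemma neg_log_one_sub_le {x S : ℝ} (hx : |x| ≤ S) (hS : S < 1) :
    -Real.log (1 - x) ≤ x + x ^ 2 * ((3 - S) / (6 * (1 - S))) := by
  rcases le_total 0 x with h0 | h0
  · have hxS : x ≤ S := (le_abs_self x).trans hx
    refine (neg_log_one_sub_le_of_nonneg h0 (hxS.trans_lt hS)).trans ?_
    have : (3 - x) / (6 * (1 - x)) ≤ (3 - S) / (6 * (1 - S)) := by
      rw [div_le_div_iff₀ (by linarith) (by linarith)]
      nlinarith
    rw [mul_div_assoc]
    gcongr
  · have hS0 : 0 ≤ S := (abs_nonneg x).trans hx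
    have h1 := Real.le_log_one_add_of_nonneg (x := -x) (by linarith)
    have h2 : -x - x ^ 2 / 2 ≤ 2 * -x / (-x + 2) := by
      rw [le_div_iff₀ (by linarith)]
      nlinarith [mul_nonneg (neg_nonneg.2 h0) (sq_nonneg x)]
    have h3 : 1 / 2 ≤ (3 - S) / (6 * (1 - S)) := by
      rw [div_le_div_iff₀ (by norm_num) (by linarith)]
      linarith
    have h4 := mul_le_mul_of_nonneg_left h3 (sq_nonneg x)
    rw [show 1 - x = 1 + -x by ring]
    linarith

lemma lintegral_exp_mul_sq_gaussianReal {μ : ℝ} (hμ : 2 * μ < 1) :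
    ∫⁻ x, ENNReal.ofReal (Real.exp (μ * x ^ 2)) ∂(gaussianReal 0 1) =
      ENNReal.ofReal (Real.exp (-Real.log (1 - 2 * μ) / 2)) := by
  have hb : 0 < 1 / 2 - μ := by linarith
  rw [gaussianReal_of_var_ne_zero 0 one_ne_zero,
    lintegral_withDensity_eq_lintegral_mul _ (measurable_gaussianPDF 0 1) (by fun_prop)]
  have h1 : ∀ x : ℝ, (gaussianPDF 0 1 * fun x => ENNReal.ofReal (Real.exp (μ * x ^ 2))) x =
      ENNReal.ofReal ((√(2 * Real.pi))⁻¹ * Real.exp (-(1 / 2 - μ) * x ^ 2)) := by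
    intro x
    rw [Pi.mul_apply, gaussianPDF_def, ← ENNReal.ofReal_mul (gaussianPDFReal_nonneg 0 1 x),
      gaussianPDFReal_def, mul_assoc, ← Real.exp_add]
    congr 2
    · simp
    · congr 1
      simp
      ring
  simp_rw [h1]
  rw [← ofReal_integral_eq_lintegral_ofReal ((integrable_exp_neg_mul_sq hb).const_mul _)
    (Filter.Eventually.of_forall fun x => by positivity), integral_const_mul, integral_gaussian]
  congr 1
  rw [← Real.sqrt_inv, ← Real.sqrt_mul (by positivity), Real.sqrt_eq_iff_mul_self_eq
    (by positivity) (Real.exp_pos _).le, ← Real.exp_add, ← add_div, ← two_mul,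
    mul_div_cancel_left₀ _ two_ne_zero, Real.exp_neg, Real.exp_log (by linarith)]
  have : 1 - 2 * μ ≠ 0 := by linarith
  have := hb.ne'
  field_simp

section QuadraticForm

variable {ι : Type*} [Fintype ι] [DecidableEq ι]

lemma sum_sq_eigenvalues {M : Matrix ι ι ℝ} (hM : M.IsHermitian) :
    ∑ i, hM.eigenvalues i ^ 2 = ∑ i, ∑ j, M i j ^ 2 := by
  have h1 : (M * M).trace = ∑ i, ∑ j, M i j ^ 2 := by
    simp only [Matrix.trace, Matrix.diag_apply, Matrix.mul_apply]
    refine Finset.sum_congr rfl fun i _ => Finset.sum_congr rfl fun j _ => ?_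
    have := hM.apply i j
    simp only [star_trivial] at this
    rw [this, sq]
  rw [← h1]
  conv_rhs => rw [hM.spectral_theorem, ← map_mul, Unitary.conjStarAlgAut_apply,
    Matrix.trace_mul_cycle, Unitary.coe_star_mul_self, one_mul, Matrix.diagonal_mul_diagonal,
    Matrix.trace_diagonal]
  simp [sq]

lemma dotProduct_mulVec_sum_eigenvectorBasis {M : Matrix ι ι ℝ} (hM : M.IsHermitian)
    (x : ι → ℝ) :
    (∑ i, x i • (hM.eigenvectorBasis i).ofLp) ⬝ᵥ
      M *ᵥ (∑ i, x i • (hM.eigenvectorBasis i).ofLp) = ∑ i, hM.eigenvalues i * x i ^ 2 := by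
  have horth : ∀ i j, (hM.eigenvectorBasis i).ofLp ⬝ᵥ (hM.eigenvectorBasis j).ofLp =
      if i = j then 1 else 0 := by
    intro i j
    have := orthonormal_iff_ite.1 hM.eigenvectorBasis.orthonormal j i
    rw [EuclideanSpace.inner_eq_star_dotProduct] at this
    simpa [eq_comm] using this
  simp only [Matrix.mulVec_sum, Matrix.mulVec_smul, hM.mulVec_eigenvectorBasis, sum_dotProduct,
    dotProduct_sum, smul_dotProduct, dotProduct_smul, horth]
  simp
  exact Finset.sum_congr rfl fun i _ => by ring

/-- The exponential moment of a quadratic form in standard Gaussian variables. The form is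
diagonalised by a rotation, under which the Gaussian measure is invariant. -/
lemma lintegral_exp_quadForm_gaussian {M : Matrix ι ι ℝ} (hM : M.IsHermitian) {S : ℝ}
    (hS0 : 0 ≤ S) (hS : S < 1) (hMS : 4 * ∑ i, ∑ j, M i j ^ 2 ≤ S ^ 2) :
    ∫⁻ x, ENNReal.ofReal (Real.exp (x ⬝ᵥ M *ᵥ x)) ∂(Measure.pi fun _ : ι => gaussianReal 0 1) ≤
      ENNReal.ofReal (Real.exp (M.trace +
        (∑ i, ∑ j, M i j ^ 2) * ((3 - S) / (3 * (1 - S))))) := by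
  have hev : ∀ i, |2 * hM.eigenvalues i| ≤ S := by
    intro i
    apply abs_le_of_sq_le_sq _ hS0
    have := Finset.single_le_sum (f := fun i => hM.eigenvalues i ^ 2)
      (fun i _ => sq_nonneg _) (Finset.mem_univ i)
    rw [sum_sq_eigenvalues] at this
    linarith [mul_pow 2 (hM.eigenvalues i) 2]
  have hrot : ∫⁻ x, ENNReal.ofReal (Real.exp (x ⬝ᵥ M *ᵥ x))
        ∂(Measure.pi fun _ : ι => gaussianReal 0 1) =
      ∫⁻ x, ∏ i, ENNReal.ofReal (Real.exp (hM.eigenvalues i * x i ^ 2))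
        ∂(Measure.pi fun _ : ι => gaussianReal 0 1) := by
    let f : EuclideanSpace ℝ ι → ℝ≥0∞ :=
      fun z => ENNReal.ofReal (Real.exp (z.ofLp ⬝ᵥ M *ᵥ z.ofLp))
    have hf : Measurable f := by
      refine ENNReal.measurable_ofReal.comp (Continuous.measurable ?_)
      exact Real.continuous_exp.comp (Continuous.dotProduct (PiLp.continuous_ofLp 2 _)
        (Continuous.matrix_mulVec continuous_const (PiLp.continuous_ofLp 2 _)))
    have h1 := lintegral_map (μ := Measure.pi fun _ : ι => gaussianReal 0 1) hf
      (WithLp.measurable_toLp 2 (ι → ℝ))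
    have h2 := lintegral_map (μ := Measure.pi fun _ : ι => gaussianReal 0 1) hf
      (g := fun x : ι → ℝ => ∑ i, x i • hM.eigenvectorBasis i) (by fun_prop)
    rw [map_pi_eq_stdGaussian, stdGaussian_eq_map_pi_orthonormalBasis hM.eigenvectorBasis] at h1
    rw [h1] at h2
    simp only [f] at h2
    rw [h2]
    refine lintegral_congr fun x => ?_
    rw [WithLp.ofLp_sum]
    simp only [WithLp.ofLp_smul]
    rw [dotProduct_mulVec_sum_eigenvectorBasis, Real.exp_sum,
      ENNReal.ofReal_prod_of_nonneg fun _ _ => (Real.exp_pos _).le]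
  have hprod : ∫⁻ x, ∏ i, ENNReal.ofReal (Real.exp (hM.eigenvalues i * x i ^ 2))
        ∂(Measure.pi fun _ : ι => gaussianReal 0 1) =
      ∏ i, ∫⁻ x, ENNReal.ofReal (Real.exp (hM.eigenvalues i * x ^ 2)) ∂(gaussianReal 0 1) := by
    rw [lintegral_prod_eq_prod_lintegral_of_indepFun Finset.univ
      (fun i (x : ι → ℝ) => ENNReal.ofReal (Real.exp (hM.eigenvalues i * x i ^ 2)))
      (iIndepFun_pi (X := fun i x => ENNReal.ofReal (Real.exp (hM.eigenvalues i * x ^ 2)))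
        fun i => by fun_prop) (fun i => by fun_prop)]
    refine Finset.prod_congr rfl fun i _ => ?_
    exact (measurePreserving_eval (fun _ : ι => gaussianReal 0 1) i).lintegral_comp
      (f := fun x => ENNReal.ofReal (Real.exp (hM.eigenvalues i * x ^ 2))) (by fun_prop)
  rw [hrot, hprod]
  have hone : ∀ i, ∫⁻ x, ENNReal.ofReal (Real.exp (hM.eigenvalues i * x ^ 2))
        ∂(gaussianReal 0 1) ≤ ENNReal.ofReal (Real.exp (hM.eigenvalues i +
          hM.eigenvalues i ^ 2 * ((3 - S) / (3 * (1 - S))))) := by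
    intro i
    rw [lintegral_exp_mul_sq_gaussianReal (((le_abs_self _).trans (hev i)).trans_lt hS)]
    apply ENNReal.ofReal_le_ofReal
    apply Real.exp_le_exp.2
    have := neg_log_one_sub_le (hev i) hS
    have e : (3 - S) / (3 * (1 - S)) = 2 * ((3 - S) / (6 * (1 - S))) := by
      have : 1 - S ≠ 0 := by linarith
      field_simp
      ring
    rw [e]
    nlinarith
  refine (Finset.prod_le_prod' fun i _ => hone i).trans (le_of_eq ?_)
  rw [← ENNReal.ofReal_prod_of_nonneg fun _ _ => (Real.exp_pos _).le, ← Real.exp_sum,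
    Finset.sum_add_distrib, ← Finset.sum_mul, sum_sq_eigenvalues, hM.trace_eq_sum_eigenvalues]
  simp

end QuadraticForm

/-! ### From signs to Gaussian variables -/

/-- The Rademacher law: the values `1` and `-1`, each with probability `1/2`. -/
noncomputable def rademacher : Measure ℝ :=
  (2⁻¹ : ℝ≥0∞) • Measure.dirac 1 + (2⁻¹ : ℝ≥0∞) • Measure.dirac (-1)

instance : IsProbabilityMeasure rademacher where
  measure_univ := by simp [rademacher, ENNReal.inv_two_add_inv_two]

lemma lintegral_rademacher {f : ℝ → ℝ≥0∞} :
    ∫⁻ s, f s ∂rademacher = 2⁻¹ * f 1 + 2⁻¹ * f (-1) := by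
  simp [rademacher]

lemma ae_sq_eq_one_rademacher : ∀ᵐ s ∂rademacher, s ^ 2 = 1 := by
  have hm : MeasurableSet {s : ℝ | s ^ 2 = 1} :=
    measurableSet_eq_fun (by fun_prop) measurable_const
  rw [rademacher, ae_add_measure_iff]
  constructor <;> refine Measure.ae_smul_measure ?_ _ <;> rw [ae_dirac_iff hm] <;> norm_num

/-- Exponential moments grow when a sign is replaced by a standard Gaussian variable. -/
lemma lintegral_exp_rademacher_le (c l : ℝ) :
    ∫⁻ s, ENNReal.ofReal (Real.exp (c + s * l)) ∂rademacher ≤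
      ∫⁻ s, ENNReal.ofReal (Real.exp (c + s * l)) ∂(gaussianReal 0 1) := by
  have hg : ∫⁻ s, ENNReal.ofReal (Real.exp (c + s * l)) ∂(gaussianReal 0 1) =
      ENNReal.ofReal (Real.exp (c + l ^ 2 / 2)) := by
    have hi : Integrable (fun s => Real.exp (c + s * l)) (gaussianReal 0 1) := by
      simp_rw [Real.exp_add, mul_comm _ l]
      exact (integrable_exp_mul_gaussianReal l).const_mul _
    rw [← ofReal_integral_eq_lintegral_ofReal hi
      (Filter.Eventually.of_forall fun _ => (Real.exp_pos _).le)]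
    congr 1
    simp_rw [Real.exp_add, mul_comm _ l, integral_const_mul]
    congr 1
    have := congrFun (mgf_fun_id_gaussianReal (μ := 0) (v := 1)) l
    simpa [mgf] using this
  have h2 : (2⁻¹ : ℝ≥0∞) = ENNReal.ofReal 2⁻¹ := by
    rw [ENNReal.ofReal_inv_of_pos two_pos]
    simp
  rw [hg, lintegral_rademacher, h2, ← ENNReal.ofReal_mul (by norm_num),
    ← ENNReal.ofReal_mul (by norm_num), ← ENNReal.ofReal_add (by positivity) (by positivity)]
  apply ENNReal.ofReal_le_ofReal
  have := mul_le_mul_of_nonneg_left (Real.cosh_le_exp_half_sq l) (Real.exp_pos c).le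
  rw [Real.cosh_eq] at this
  rw [Real.exp_add c (l ^ 2 / 2), one_mul, neg_one_mul, Real.exp_add, Real.exp_add]
  linarith

lemma measurable_exp_quadForm {ι : Type*} [Fintype ι] (M : Matrix ι ι ℝ) :
    Measurable fun x : ι → ℝ => ENNReal.ofReal (Real.exp (x ⬝ᵥ M *ᵥ x)) := by
  refine ENNReal.measurable_ofReal.comp (Continuous.measurable ?_)
  exact Real.continuous_exp.comp (Continuous.dotProduct continuous_id
    (Continuous.matrix_mulVec continuous_const continuous_id))

section Replacement

variable {ι : Type*} [Fintype ι] [DecidableEq ι]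

/-- If an integral does not decrease when a single coordinate measure `μ` is replaced by `ν`, then
it does not decrease when all of them are. -/
lemma lintegral_pi_le_of_forall_update {X : ι → Type*} [∀ i, MeasurableSpace (X i)]
    (μ ν : ∀ i, Measure (X i)) [∀ i, SigmaFinite (μ i)] [∀ i, SigmaFinite (ν i)]
    {f : (∀ i, X i) → ℝ≥0∞} (hf : Measurable f)
    (h : ∀ i x, ∫⁻ s, f (Function.update x i s) ∂(μ i) ≤
      ∫⁻ s, f (Function.update x i s) ∂(ν i)) :
    ∫⁻ x, f x ∂(Measure.pi μ) ≤ ∫⁻ x, f x ∂(Measure.pi ν) := by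
  have key : ∀ s : Finset ι, ∀ x, lmarginal μ s f x ≤ lmarginal ν s f x := by
    intro s
    induction s using Finset.induction_on with
    | empty => simp
    | insert i s hi ih =>
      intro x
      -- the measure with `μ` at `i` and `ν` elsewhere lets the two integrals be exchanged
      let ρ : ∀ j, Measure (X j) := Function.update ν i (μ i)
      have hρ : ∀ j, SigmaFinite (ρ j) := by
        intro j
        by_cases hj : j = i
        · subst hj
          simp only [ρ, Function.update_self]
          infer_instance
        · simp only [ρ, Function.update_of_ne hj]
          infer_instance
      have hρs : ∀ g, lmarginal ρ s g = lmarginal ν s g := by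
        intro g
        have : (fun j : s => ρ j) = fun j : s => ν j := by
          funext j
          have : (j : ι) ≠ i := fun e => hi (e ▸ j.2)
          simp only [ρ, Function.update_of_ne this]
        ext y
        rw [lmarginal, lmarginal, this]
      calc lmarginal μ (insert i s) f x
          = ∫⁻ t, lmarginal μ s f (Function.update x i t) ∂(μ i) :=
            lmarginal_insert f hf hi x
        _ ≤ ∫⁻ t, lmarginal ν s f (Function.update x i t) ∂(μ i) :=
            lintegral_mono fun t => ih _
        _ = lmarginal ρ (insert i s) f x := by
            rw [lmarginal_insert f hf hi x, hρs]
            simp only [ρ, Function.update_self]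
        _ = lmarginal ν s (fun y => ∫⁻ t, f (Function.update y i t) ∂(μ i)) x := by
            rw [lmarginal_insert' f hf hi, hρs]
            simp only [ρ, Function.update_self]
        _ ≤ lmarginal ν s (fun y => ∫⁻ t, f (Function.update y i t) ∂(ν i)) x :=
            lmarginal_mono (fun y => h i y) x
        _ = lmarginal ν (insert i s) f x := by rw [lmarginal_insert' f hf hi]
  by_cases hX : Nonempty (∀ i, X i)
  · obtain ⟨x⟩ := hX
    rw [lintegral_eq_lmarginal_univ x, lintegral_eq_lmarginal_univ x]
    exact key Finset.univ x
  · rw [not_nonempty_iff] at hX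
    simp [lintegral_of_isEmpty]

/-- A quadratic form without diagonal terms is affine in each coordinate. -/
lemma quadForm_update {M : Matrix ι ι ℝ} {i : ι} (hM : M i i = 0) (x : ι → ℝ) :
    ∃ c l : ℝ, ∀ s, Function.update x i s ⬝ᵥ M *ᵥ Function.update x i s = c + s * l := by
  let z := Function.update x i 0
  let e : ι → ℝ := Pi.single i 1
  refine ⟨z ⬝ᵥ M *ᵥ z, z ⬝ᵥ M *ᵥ e + e ⬝ᵥ M *ᵥ z, fun s => ?_⟩
  have : Function.update x i s = z + s • e := by
    ext j
    by_cases hj : j = i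
    · subst hj
      simp [z, e]
    · simp [z, e, hj]
  have he : e ⬝ᵥ M *ᵥ e = 0 := by simp [e, hM]
  rw [this]
  simp only [Matrix.mulVec_add, Matrix.mulVec_smul, add_dotProduct, dotProduct_add,
    smul_dotProduct, dotProduct_smul, he, smul_eq_mul]
  ring

/-- The law of an entry of the ensemble, rescaled to variance one. -/
def IsEntryLaw (ν : Measure ℝ) : Prop := ν = gaussianReal 0 1 ∨ ν = rademacher

lemma IsEntryLaw.isProbabilityMeasure {ν : Measure ℝ} (hν : IsEntryLaw ν) :
    IsProbabilityMeasure ν := by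
  rcases hν with rfl | rfl <;> infer_instance

/-- The Gaussian bound for the exponential moment of a quadratic form also holds for signs: the
diagonal part of the form is then constant, and the off-diagonal part is affine in each
coordinate. -/
lemma lintegral_exp_quadForm_le {ν : Measure ℝ} (hν : IsEntryLaw ν) {M : Matrix ι ι ℝ}
    (hM : M.IsHermitian) {S : ℝ} (hS0 : 0 ≤ S) (hS : S < 1)
    (hMS : 4 * ∑ i, ∑ j, M i j ^ 2 ≤ S ^ 2) :
    ∫⁻ x, ENNReal.ofReal (Real.exp (x ⬝ᵥ M *ᵥ x)) ∂(Measure.pi fun _ : ι => ν) ≤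
      ENNReal.ofReal (Real.exp (M.trace +
        (∑ i, ∑ j, M i j ^ 2) * ((3 - S) / (3 * (1 - S))))) := by
  rcases hν with rfl | rfl
  · exact lintegral_exp_quadForm_gaussian hM hS0 hS hMS
  let D : Matrix ι ι ℝ := Matrix.diagonal fun i => M i i
  let N := M - D
  have hN0 : ∀ i, N i i = 0 := fun i => by simp [N, D]
  have hN : N.IsHermitian := hM.sub (Matrix.isHermitian_diagonal _)
  have hNM : ∑ i, ∑ j, N i j ^ 2 ≤ ∑ i, ∑ j, M i j ^ 2 := by
    refine Finset.sum_le_sum fun i _ => Finset.sum_le_sum fun j _ => ?_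
    by_cases hij : i = j
    · subst hij
      rw [hN0, zero_pow two_ne_zero]
      positivity
    · simp [N, D, Matrix.diagonal_apply_ne _ hij]
  have htr : N.trace = 0 := Finset.sum_eq_zero fun i _ => hN0 i
  have hae : ∀ᵐ x ∂(Measure.pi fun _ : ι => rademacher), ∀ i, x i ^ 2 = 1 := by
    rw [ae_all_iff]
    intro i
    exact (Measure.tendsto_eval_ae_ae (μ := fun _ : ι => rademacher) (i := i)).eventually
      ae_sq_eq_one_rademacher
  have hsplit : ∫⁻ x, ENNReal.ofReal (Real.exp (x ⬝ᵥ M *ᵥ x))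
        ∂(Measure.pi fun _ : ι => rademacher) =
      ENNReal.ofReal (Real.exp M.trace) *
        ∫⁻ x, ENNReal.ofReal (Real.exp (x ⬝ᵥ N *ᵥ x)) ∂(Measure.pi fun _ : ι => rademacher) := by
    rw [← lintegral_const_mul _ (measurable_exp_quadForm N)]
    refine lintegral_congr_ae ?_
    filter_upwards [hae] with x hx
    rw [← ENNReal.ofReal_mul (Real.exp_pos _).le, ← Real.exp_add]
    congr 2
    have hD : x ⬝ᵥ D *ᵥ x = M.trace := by
      simp only [D, Matrix.mulVec_diagonal, dotProduct, Matrix.trace, Matrix.diag_apply]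
      exact Finset.sum_congr rfl fun i _ => by linear_combination M i i * hx i
    rw [Matrix.sub_mulVec, dotProduct_sub, hD]
    ring
  have hrep := lintegral_pi_le_of_forall_update (fun _ : ι => rademacher)
    (fun _ : ι => gaussianReal 0 1) (measurable_exp_quadForm N) (by
      intro i x
      obtain ⟨c, l, h⟩ := quadForm_update (hN0 i) x
      simp_rw [h]
      exact lintegral_exp_rademacher_le c l)
  rw [hsplit, Real.exp_add, ENNReal.ofReal_mul (Real.exp_pos _).le]
  gcongr
  refine (hrep.trans (lintegral_exp_quadForm_gaussian hN hS0 hS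
    (le_trans (by linarith) hMS))).trans ?_
  rw [htr, zero_add]
  have h1 : 0 < 1 - S := by linarith
  have h2 : 0 < 3 - S := by linarith
  gcongr

end Replacement

/-! ### The reconstruction step of thresholding -/

lemma pinv_apply_of_mem_range {E F : Type*} [NormedAddCommGroup E] [InnerProductSpace ℝ E]
    [FiniteDimensional ℝ E] [NormedAddCommGroup F] [InnerProductSpace ℝ F]
    [FiniteDimensional ℝ F] (T : E →ₗ[ℝ] F) {s : F} (hs : s ∈ LinearMap.range T) :
    T (pinv T s) = s := by
  have h1 : ∀ r : LinearMap.range T, T ((T.kerComplementEquivRange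
      (Submodule.isCompl_orthogonal (LinearMap.ker T)).symm).symm r : E) = r := by
    intro r
    have := congrArg Subtype.val ((T.kerComplementEquivRange
      (Submodule.isCompl_orthogonal (LinearMap.ker T)).symm).apply_symm_apply r)
    simpa using this
  have h2 : ((LinearMap.range T).orthogonalProjectionOnto s : F) = s := by
    simpa using Submodule.starProjection_eq_self_iff.2 hs
  calc T (pinv T s) = ((LinearMap.range T).orthogonalProjectionOnto s : F) := h1 _
    _ = s := h2

section Recovery

variable {n d K : ℕ}

lemma mulVec_eq_submatrix_mulVec {m : ℕ} (Φ : Matrix (Fin m) (Fin K) ℝ) {Λ : Finset (Fin K)}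
    {x : Fin K → ℝ} (hx : ∀ j ∉ Λ, x j = 0) :
    Φ *ᵥ x = Φ.submatrix id (fun i : {i // i ∈ Λ} => (i : Fin K)) *ᵥ fun i => x i := by
  ext r
  simp only [Matrix.mulVec, dotProduct, Matrix.submatrix_apply, id_eq]
  rw [Finset.sum_coe_sort Λ (fun j => Φ r j * x j)]
  exact (Finset.sum_subset (Finset.subset_univ Λ) fun j _ hj => by rw [hx j hj, mul_zero]).symm

lemma output_of_notMem (Φ : Matrix (Fin n) (Fin K) ℝ) (s : Fin n → ℝ) {Λ : Finset (Fin K)}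
    {j : Fin K} (hj : j ∉ Λ) : output Φ s Λ j = 0 := dif_neg hj

/-- Data that are a combination of the selected columns are reproduced by the output. -/
lemma mulVec_output (Φ : Matrix (Fin n) (Fin K) ℝ) {Λ : Finset (Fin K)} {x : Fin K → ℝ}
    (hx : ∀ j ∉ Λ, x j = 0) : Φ *ᵥ output Φ (Φ *ᵥ x) Λ = Φ *ᵥ x := by
  rw [mulVec_eq_submatrix_mulVec Φ fun j hj => output_of_notMem Φ _ hj]
  let T := Matrix.toEuclideanLin (Φ.submatrix id (fun i : {i // i ∈ Λ} => (i : Fin K)))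
  have hmem : WithLp.toLp 2 (Φ *ᵥ x) ∈ LinearMap.range T := by
    refine ⟨WithLp.toLp 2 fun i => x i, ?_⟩
    simp [T, Matrix.toLpLin_apply, mulVec_eq_submatrix_mulVec Φ hx]
  have h := congrArg WithLp.ofLp (pinv_apply_of_mem_range T hmem)
  simp only [T, Matrix.toLpLin_apply] at h
  rw [← h]
  congr 1
  ext i
  simp [output, h]

lemma mulVec_mem_span (Ψ : Matrix (Fin d) (Fin K) ℝ) {Λ : Finset (Fin K)} {z : Fin K → ℝ}
    (hz : ∀ j ∉ Λ, z j = 0) :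
    Ψ *ᵥ z ∈ Submodule.span ℝ (Ψ.col '' (Λ : Set (Fin K))) := by
  have : Ψ *ᵥ z = ∑ j, z j • Ψ.col j := by
    ext r
    simp [Matrix.mulVec, dotProduct, Finset.sum_apply, mul_comm]
  rw [this]
  refine Submodule.sum_mem _ fun j _ => ?_
  by_cases hj : j ∈ Λ
  · exact Submodule.smul_mem _ _ (Submodule.subset_span (Set.mem_image_of_mem _ hj))
  · simp [hz j hj]

/-- A strict separation of the correlations on the support from those off the support is all that
thresholding needs. -/
lemma recovers_of_separated (A : Matrix (Fin n) (Fin d) ℝ) (Ψ : Matrix (Fin d) (Fin K) ℝ)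
    (x : Fin K → ℝ)
    (hsep : ∀ i ∈ supp x, ∀ k ∉ supp x,
      |(A *ᵥ (Ψ *ᵥ x)) ⬝ᵥ (A * Ψ).col k| < |(A *ᵥ (Ψ *ᵥ x)) ⬝ᵥ (A * Ψ).col i|) :
    Recovers A Ψ x := by
  have hx : ∀ j ∉ supp x, x j = 0 := fun j hj => by simpa [supp] using hj
  refine ⟨⟨supp x, rfl, fun i hi k hk => (hsep i hi k hk).le⟩, ?_⟩
  rintro Λ ⟨hcard, hΛ⟩
  have hEq : Λ = supp x := by
    by_contra hne
    have h1 : ¬ Λ ⊆ supp x := fun h => hne (Finset.eq_of_subset_of_card_le h hcard.ge)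
    have h2 : ¬ supp x ⊆ Λ := fun h => hne (Finset.eq_of_subset_of_card_le h hcard.le).symm
    obtain ⟨k, hkΛ, hk⟩ := Finset.not_subset.1 h1
    obtain ⟨i, hi, hiΛ⟩ := Finset.not_subset.1 h2
    exact (hsep i hi k hk).not_ge (hΛ k hkΛ i hiΛ)
  subst hEq
  have hout : (A * Ψ) *ᵥ output (A * Ψ) (A *ᵥ (Ψ *ᵥ x)) (supp x) = (A * Ψ) *ᵥ x := by
    rw [Matrix.mulVec_mulVec]
    exact mulVec_output (A * Ψ) hx
  have hout0 : ∀ j ∉ supp x, output (A * Ψ) (A *ᵥ (Ψ *ᵥ x)) (supp x) j = 0 :=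
    fun j hj => output_of_notMem _ _ hj
  refine ⟨rfl, fun hinj => ?_, fun hli => ?_⟩
  · refine hinj (mulVec_mem_span Ψ hout0) (mulVec_mem_span Ψ hx) ?_
    simpa only [Matrix.mulVec_mulVec] using hout
  · have hinj : Function.Injective ((A * Ψ).submatrix id
        (fun i : {i // i ∈ supp x} => (i : Fin K))).mulVec := Matrix.mulVec_injective_iff.2 hli
    have h := hinj ((mulVec_eq_submatrix_mulVec _ hout0).symm.trans
      (hout.trans (mulVec_eq_submatrix_mulVec _ hx)))
    ext j
    by_cases hj : j ∈ supp x
    · exact congrFun h ⟨j, hj⟩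
    · rw [hout0 j hj, hx j hj]

/-- Let `ρ_k = ⟨y, ψ_k⟩`. If the deviation of each `⟨Ay, Aψ_k⟩` from `‖Ay‖² ρ_k`, not from `ρ_k`
itself, is less than `‖Ay‖² ε / 2`, then the margin `ε` keeps the correlations separated. -/
lemma recovers_of_deviation_lt (A : Matrix (Fin n) (Fin d) ℝ) (Ψ : Matrix (Fin d) (Fin K) ℝ)
    (x : Fin K → ℝ) {ε : ℝ} (hmargin : HasMargin Ψ (Ψ *ᵥ x) (supp x) ε)
    (hdev : ∀ k, |(A *ᵥ (Ψ *ᵥ x)) ⬝ᵥ (A *ᵥ (Ψ.col k - ((Ψ *ᵥ x) ⬝ᵥ Ψ.col k) • (Ψ *ᵥ x)))| <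
      ε / 2 * ((A *ᵥ (Ψ *ᵥ x)) ⬝ᵥ (A *ᵥ (Ψ *ᵥ x)))) :
    Recovers A Ψ x := by
  set y := Ψ *ᵥ x
  set s := A *ᵥ y
  refine recovers_of_separated A Ψ x fun i hi k hk => ?_
  have hρ : |y ⬝ᵥ Ψ.col k| + ε < |y ⬝ᵥ Ψ.col i| := by
    refine (add_le_add_left ?_ ε).trans_lt (hmargin.trans_le ?_)
    · exact le_ciSup (f := fun k : {k // k ∉ supp x} => |y ⬝ᵥ Ψ.col k|)
        (Set.finite_range _).bddAbove ⟨k, hk⟩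
    · exact ciInf_le (f := fun i : {i // i ∈ supp x} => |y ⬝ᵥ Ψ.col i|)
        (Set.finite_range _).bddBelow ⟨i, hi⟩
  have hdec : ∀ j, s ⬝ᵥ (A * Ψ).col j = (y ⬝ᵥ Ψ.col j) * (s ⬝ᵥ s) +
      s ⬝ᵥ (A *ᵥ (Ψ.col j - (y ⬝ᵥ Ψ.col j) • y)) := by
    intro j
    have : (A * Ψ).col j = A *ᵥ Ψ.col j := by
      ext r
      simp [Matrix.mul_apply, Matrix.mulVec, dotProduct]
    rw [this, Matrix.mulVec_sub, Matrix.mulVec_smul, dotProduct_sub, dotProduct_smul, smul_eq_mul]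
    ring
  have hN : 0 ≤ s ⬝ᵥ s := by simpa using dotProduct_self_star_nonneg s
  have hi' := hdev i
  have hk' := hdev k
  rw [hdec i, hdec k]
  set N := s ⬝ᵥ s
  have h1 := abs_add_le ((y ⬝ᵥ Ψ.col k) * N) (s ⬝ᵥ (A *ᵥ (Ψ.col k - (y ⬝ᵥ Ψ.col k) • y)))
  have h2 := abs_sub_abs_le_abs_add ((y ⬝ᵥ Ψ.col i) * N)
    (s ⬝ᵥ (A *ᵥ (Ψ.col i - (y ⬝ᵥ Ψ.col i) • y)))
  rw [abs_mul, abs_of_nonneg hN] at h1 h2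
  have h3 := mul_le_mul_of_nonneg_right hρ.le hN
  linarith

end Recovery

/-! ### The constants -/

lemma four_mul_C₁_bounds : 10.01 ≤ 4 * C₁ ∧ 4 * C₁ ≤ 10.018 := by
  have he1 := Real.exp_one_gt_d9
  have he2 := Real.exp_one_lt_d9
  have hp1 := Real.pi_gt_d6
  have hp2 := Real.pi_lt_d6
  have h1 : √(6 * Real.pi) ≤ 4.3417 := Real.sqrt_le_iff.2 ⟨by norm_num, by linarith⟩
  have h2 : 4.3416 ≤ √(6 * Real.pi) := Real.le_sqrt_of_sq_le (by linarith)
  have h0 : 0 < √(6 * Real.pi) := by linarith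
  unfold C₁
  rw [← mul_div_assoc]
  exact ⟨by rw [le_div_iff₀ h0]; linarith, by rw [div_le_iff₀ h0]; linarith⟩

lemma two_mul_C₂_bounds : 7.68 ≤ 2 * C₂ ∧ 2 * C₂ ≤ 7.689 := by
  have he1 := Real.exp_one_gt_d9
  have he2 := Real.exp_one_lt_d9
  have h1 : √2 ≤ 1.41422 := Real.sqrt_le_iff.2 ⟨by norm_num, by norm_num⟩
  have h2 : 1.4142 ≤ √2 := Real.le_sqrt_of_sq_le (by norm_num)
  unfold C₂
  constructor <;> nlinarith

lemma C_pos {ε : ℝ} (hε : 0 < ε) : 0 < C ε := by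
  have h1 := four_mul_C₁_bounds.1
  have h2 := two_mul_C₂_bounds.1
  have : 0 < 4 * C₁ := by linarith
  have : 0 < 2 * C₂ := by linarith
  unfold C
  positivity

lemma C_le {ε : ℝ} (hε : 0 < ε) (hε1 : ε ≤ 1) : C ε ≤ (4 * C₁ + 2 * C₂) / ε ^ 2 := by
  have h2 : 0 ≤ 2 * C₂ := by linarith [two_mul_C₂_bounds.1]
  unfold C
  rw [add_div]
  gcongr
  nlinarith

/-- An affine majorant of `√(1 / 2 + ε ^ 2 / 4)` on `[0, 1]`. -/
noncomputable def frobBound (ε : ℝ) : ℝ := 0.7072 + 0.159 * ε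

/-- The exponential rate at which the probability of a large deviation decays in the number of
measurements. -/
noncomputable def rate (ε : ℝ) : ℝ :=
  ε ^ 2 * (3 * frobBound ε + 2 * ε) / (12 * frobBound ε * (2 * frobBound ε + ε) ^ 2)

lemma frobBound_pos {ε : ℝ} (hε : 0 < ε) : 0 < frobBound ε := by
  unfold frobBound
  positivity

lemma le_frobBound_sq {ε : ℝ} (hε : 0 < ε) (hε1 : ε ≤ 1) :
    1 / 2 + ε ^ 2 / 4 ≤ frobBound ε ^ 2 := by
  unfold frobBound
  nlinarith

lemma one_lt_C_mul_rate {ε : ℝ} (hε : 0 < ε) (hε1 : ε ≤ 1) : 1 < C ε * rate ε := by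
  have h1 := four_mul_C₁_bounds.1
  have h2 := two_mul_C₂_bounds.1
  have hs := frobBound_pos hε
  have hC : C ε * ε ^ 2 = 4 * C₁ + 2 * C₂ * ε := by
    unfold C
    field_simp
  have hb : 10.01 + 7.68 * ε ≤ C ε * ε ^ 2 := by
    rw [hC]
    nlinarith
  unfold rate
  rw [mul_div_assoc', one_lt_div (by positivity), ← mul_assoc]
  refine lt_of_lt_of_le ?_ (mul_le_mul_of_nonneg_right hb (by positivity))
  unfold frobBound
  nlinarith [mul_pos hε hε, mul_nonneg hε.le (sub_nonneg.2 hε1),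
    mul_nonneg (mul_pos hε hε).le (sub_nonneg.2 hε1)]

/-! ### Deviation of the correlations -/

section Deviation

variable {n d : ℕ} {ν : Measure ℝ}

/-- The symmetric matrix of the quadratic form `l * (⟨g, u⟩ ⟨g, w⟩ - ε / 2 * ⟨g, u⟩ ^ 2)`. -/
noncomputable def devMatrix (l ε : ℝ) (u w : Fin d → ℝ) : Matrix (Fin d) (Fin d) ℝ :=
  Matrix.of fun i j => l * ((u i * w j + w i * u j) / 2 - ε / 2 * (u i * u j))

lemma devMatrix_isHermitian (l ε : ℝ) (u w : Fin d → ℝ) : (devMatrix l ε u w).IsHermitian := by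
  ext i j
  simp only [devMatrix, Matrix.conjTranspose_apply, Matrix.of_apply, star_trivial]
  ring

lemma dotProduct_devMatrix_mulVec (l ε : ℝ) (u w g : Fin d → ℝ) :
    g ⬝ᵥ devMatrix l ε u w *ᵥ g =
      l * ((g ⬝ᵥ u) * (g ⬝ᵥ w) - ε / 2 * ((g ⬝ᵥ u) * (g ⬝ᵥ u))) := by
  have h : ∀ i j, g i * (devMatrix l ε u w i j * g j) =
      l * (((g i * u i) * (g j * w j) + (g i * w i) * (g j * u j)) / 2 -
        ε / 2 * ((g i * u i) * (g j * u j))) := by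
    intro i j
    simp only [devMatrix, Matrix.of_apply]
    ring
  simp only [dotProduct, Matrix.mulVec, Finset.mul_sum, h]
  simp only [← Finset.mul_sum, Finset.sum_sub_distrib, ← Finset.sum_div, Finset.sum_add_distrib,
    ← Finset.sum_mul]
  ring

variable {u w : Fin d → ℝ}

lemma devMatrix_trace (l ε : ℝ) (hu : u ⬝ᵥ u = 1) (huw : u ⬝ᵥ w = 0) :
    (devMatrix l ε u w).trace = -(l * ε / 2) := by
  have h : ∀ i, devMatrix l ε u w i i = l * (u i * w i - ε / 2 * (u i * u i)) := by
    intro i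
    simp only [devMatrix, Matrix.of_apply]
    ring
  simp only [dotProduct] at hu huw
  simp only [Matrix.trace, Matrix.diag_apply, h, ← Finset.mul_sum, Finset.sum_sub_distrib, hu, huw]
  ring

lemma sum_sq_devMatrix (l ε : ℝ) (hu : u ⬝ᵥ u = 1) (huw : u ⬝ᵥ w = 0) :
    ∑ i, ∑ j, devMatrix l ε u w i j ^ 2 = l ^ 2 * ((w ⬝ᵥ w) / 2 + ε ^ 2 / 4) := by
  have h : ∀ i j, devMatrix l ε u w i j ^ 2 = l ^ 2 * (((u i * u i) * (w j * w j) +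
      (w i * w i) * (u j * u j) + 2 * ((u i * w i) * (u j * w j))) / 4 -
      ε / 2 * ((u i * u i) * (u j * w j) + (u i * w i) * (u j * u j)) +
      ε ^ 2 / 4 * ((u i * u i) * (u j * u j))) := by
    intro i j
    simp only [devMatrix, Matrix.of_apply]
    ring
  simp only [dotProduct] at hu huw ⊢
  simp only [h, ← Finset.mul_sum, Finset.sum_sub_distrib, ← Finset.sum_div,
    Finset.sum_add_distrib, ← Finset.sum_mul, hu, huw]
  ring

/-- The exponential moment contributed by one measurement. -/
lemma lintegral_exp_devMatrix_le (hν : IsEntryLaw ν) (hu : u ⬝ᵥ u = 1) (huw : u ⬝ᵥ w = 0)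
    (hw : w ⬝ᵥ w ≤ 1) {ε : ℝ} (hε : 0 < ε) (hε1 : ε ≤ 1) :
    ∃ l > 0, ∫⁻ g, ENNReal.ofReal (Real.exp (g ⬝ᵥ devMatrix l ε u w *ᵥ g))
      ∂(Measure.pi fun _ : Fin d => ν) ≤ ENNReal.ofReal (Real.exp (-rate ε)) := by
  have hs := frobBound_pos hε
  have hsq := le_frobBound_sq hε hε1
  unfold rate
  set s := frobBound ε
  -- with `S = 2 * l * s` this choice of `l` amounts to `S = a / (1 + a)`, where `a = ε / (2 * s)`
  set l := ε / (2 * s * (2 * s + ε)) with hl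
  set S := ε / (2 * s + ε) with hS
  have hl0 : 0 < l := by positivity
  have hS0 : 0 < S := by positivity
  have hS1 : S < 1 := by
    rw [hS, div_lt_one (by positivity)]
    linarith
  have hSl : S = 2 * l * s := by
    rw [hS, hl]
    field_simp
  have hF : ∑ i, ∑ j, devMatrix l ε u w i j ^ 2 ≤ l ^ 2 * s ^ 2 := by
    rw [sum_sq_devMatrix l ε hu huw]
    gcongr
    linarith
  refine ⟨l, hl0, (lintegral_exp_quadForm_le hν (devMatrix_isHermitian l ε u w) hS0.le hS1
    ?_).trans ?_⟩
  · rw [hSl]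
    linarith
  · apply ENNReal.ofReal_le_ofReal
    apply Real.exp_le_exp.2
    rw [devMatrix_trace l ε hu huw]
    have h1 : 0 < 1 - S := by linarith
    have h3 : 0 ≤ (3 - S) / (3 * (1 - S)) := div_nonneg (by linarith) (by linarith)
    refine (add_le_add_right (mul_le_mul_of_nonneg_right hF h3) _).trans (le_of_eq ?_)
    have e1 : 1 - S = 2 * s / (2 * s + ε) := by
      rw [hS]
      field_simp
      ring
    have e3 : 3 - S = (6 * s + 2 * ε) / (2 * s + ε) := by
      rw [hS]
      field_simp
      ring
    rw [e1, e3, hl]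
    field_simp
    ring

/-- Rows of a matrix with independent entries of one law are independent: the exponential moment
of a sum over the rows factors. -/
lemma lintegral_prod_rows [IsProbabilityMeasure ν] {f : (Fin d → ℝ) → ℝ≥0∞} (hf : Measurable f) :
    ∫⁻ z, ∏ i, f (fun j => z (i, j)) ∂(Measure.pi fun _ : Fin n × Fin d => ν) =
      (∫⁻ g, f g ∂(Measure.pi fun _ : Fin d => ν)) ^ n := by
  let c : (Fin n → Fin d → ℝ) → Fin n × Fin d → ℝ := fun y p => y p.1 p.2
  have hc : Measurable c := by fun_prop
  have hmap : (Measure.pi fun _ : Fin n × Fin d => ν) =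
      (Measure.pi fun _ : Fin n => Measure.pi fun _ : Fin d => ν).map c := by
    refine Measure.pi_eq fun s hs => ?_
    have hpre : c ⁻¹' Set.univ.pi s =
        Set.univ.pi fun i => Set.univ.pi fun j => s (i, j) := by
      ext y
      simp [c, Set.mem_pi]
    rw [Measure.map_apply hc (MeasurableSet.univ_pi hs), hpre, Measure.pi_pi]
    simp only [Measure.pi_pi]
    rw [Fintype.prod_prod_type]
  rw [hmap, lintegral_map (by fun_prop) hc]
  have h := lintegral_prod_eq_prod_lintegral_of_indepFun Finset.univ
    (fun i (y : Fin n → Fin d → ℝ) => f (y i))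
    (iIndepFun_pi (μ := fun _ : Fin n => Measure.pi fun _ : Fin d => ν) (X := fun _ => f)
      fun _ => hf.aemeasurable) (fun i => by fun_prop)
  refine h.trans ?_
  have h1 : ∀ i : Fin n, ∫⁻ y : Fin n → Fin d → ℝ, f (y i)
      ∂(Measure.pi fun _ : Fin n => Measure.pi fun _ : Fin d => ν) =
      ∫⁻ g, f g ∂(Measure.pi fun _ : Fin d => ν) := fun i =>
    (measurePreserving_eval (fun _ : Fin n => Measure.pi fun _ : Fin d => ν) i).lintegral_comp hf
  simp [h1]

variable {Ω : Type*} [MeasurableSpace Ω] {P : Measure Ω} {A : Ω → Matrix (Fin n) (Fin d) ℝ}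

/-- The Chernoff bound for the deviation of one correlation. Both sides of the inequality that
defines the event are quadratic in `A`, so that the scale of the entries does not matter. -/
lemma measure_deviation_le (hn : 0 < n) (hν : IsEntryLaw ν)
    (hA : HasLaw (fun ω (p : Fin n × Fin d) => √(n : ℝ) * A ω p.1 p.2) (Measure.pi fun _ => ν) P)
    (hu : u ⬝ᵥ u = 1) (huw : u ⬝ᵥ w = 0) (hw : w ⬝ᵥ w ≤ 1) {ε : ℝ} (hε : 0 < ε)
    (hε1 : ε ≤ 1) :
    P {ω | ε / 2 * ((A ω *ᵥ u) ⬝ᵥ (A ω *ᵥ u)) ≤ (A ω *ᵥ u) ⬝ᵥ (A ω *ᵥ w)} ≤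
      ENNReal.ofReal (Real.exp (-(n * rate ε))) := by
  have := hν.isProbabilityMeasure
  obtain ⟨l, hl, hle⟩ := lintegral_exp_devMatrix_le hν hu huw hw hε hε1
  let f : (Fin d → ℝ) → ℝ≥0∞ := fun g =>
    ENNReal.ofReal (Real.exp (g ⬝ᵥ devMatrix l ε u w *ᵥ g))
  have hf : Measurable f := measurable_exp_quadForm _
  let E : Set (Fin n × Fin d → ℝ) := {z | 1 ≤ ∏ i, f (fun j => z (i, j))}
  have hF : Measurable fun z : Fin n × Fin d → ℝ => ∏ i, f (fun j => z (i, j)) := by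
    refine Finset.measurable_fun_prod _ fun i _ => ?_
    exact hf.comp (by fun_prop)
  have hE : MeasurableSet E := measurableSet_le measurable_const hF
  have hsub : {ω | ε / 2 * ((A ω *ᵥ u) ⬝ᵥ (A ω *ᵥ u)) ≤ (A ω *ᵥ u) ⬝ᵥ (A ω *ᵥ w)} ⊆
      (fun ω (p : Fin n × Fin d) => √(n : ℝ) * A ω p.1 p.2) ⁻¹' E := by
    intro ω hω
    simp only [Set.mem_ofPred_eq] at hω
    simp only [E, Set.mem_preimage, Set.mem_ofPred_eq, f]
    rw [← ENNReal.ofReal_prod_of_nonneg fun _ _ => (Real.exp_pos _).le, ← Real.exp_sum,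
      ENNReal.one_le_ofReal, Real.one_le_exp_iff]
    have hrow : ∀ (i : Fin n) (v : Fin d → ℝ), (fun j => √(n : ℝ) * A ω i j) ⬝ᵥ v =
        √(n : ℝ) * (A ω *ᵥ v) i := by
      intro i v
      simp only [dotProduct, Matrix.mulVec, Finset.mul_sum, mul_assoc]
    simp only [dotProduct_devMatrix_mulVec]
    simp only [hrow]
    have hterm : ∀ i, l * (√(n : ℝ) * (A ω *ᵥ u) i * (√(n : ℝ) * (A ω *ᵥ w) i) -
        ε / 2 * (√(n : ℝ) * (A ω *ᵥ u) i * (√(n : ℝ) * (A ω *ᵥ u) i))) =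
        l * n * ((A ω *ᵥ u) i * (A ω *ᵥ w) i - ε / 2 * ((A ω *ᵥ u) i * (A ω *ᵥ u) i)) := by
      intro i
      have := Real.mul_self_sqrt (Nat.cast_nonneg (α := ℝ) n)
      linear_combination l * ((A ω *ᵥ u) i * (A ω *ᵥ w) i -
        ε / 2 * ((A ω *ᵥ u) i * (A ω *ᵥ u) i)) * this
    simp only [hterm, ← Finset.mul_sum, Finset.sum_sub_distrib]
    exact mul_nonneg (by positivity) (sub_nonneg.2 hω)
  calc P {ω | ε / 2 * ((A ω *ᵥ u) ⬝ᵥ (A ω *ᵥ u)) ≤ (A ω *ᵥ u) ⬝ᵥ (A ω *ᵥ w)}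
      ≤ P ((fun ω (p : Fin n × Fin d) => √(n : ℝ) * A ω p.1 p.2) ⁻¹' E) := measure_mono hsub
    _ = (Measure.pi fun _ => ν) E := by
        rw [← hA.map_eq, Measure.map_apply_of_aemeasurable hA.aemeasurable hE]
    _ ≤ ∫⁻ z, ∏ i, f (fun j => z (i, j)) ∂(Measure.pi fun _ : Fin n × Fin d => ν) := by
        simpa using mul_meas_ge_le_lintegral (μ := Measure.pi fun _ : Fin n × Fin d => ν) hF 1
    _ ≤ ENNReal.ofReal (Real.exp (-rate ε)) ^ n := by
        rw [lintegral_prod_rows hf]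
        gcongr
    _ = ENNReal.ofReal (Real.exp (-(n * rate ε))) := by
        rw [← ENNReal.ofReal_pow (Real.exp_pos _).le, ← Real.exp_nat_mul, mul_neg]

lemma exists_hasLaw_of_ensemble [IsProbabilityMeasure P] (hn : 0 < n)
    (hA : IsGaussianEnsemble P A ∨ IsBernoulliEnsemble P A) :
    ∃ ν, IsEntryLaw ν ∧
      HasLaw (fun ω (p : Fin n × Fin d) => √(n : ℝ) * A ω p.1 p.2) (Measure.pi fun _ => ν) P := by
  have hn' : (0 : ℝ) < n := by exact_mod_cast hn
  have hjoint : ∀ ν : Measure ℝ, iIndepFun (fun (p : Fin n × Fin d) ω => A ω p.1 p.2) P →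
      (∀ i j, HasLaw (fun ω => √(n : ℝ) * A ω i j) ν P) →
      HasLaw (fun ω (p : Fin n × Fin d) => √(n : ℝ) * A ω p.1 p.2) (Measure.pi fun _ => ν) P := by
    intro ν hind hlaw
    refine ⟨aemeasurable_pi_lambda _ fun p => (hlaw p.1 p.2).aemeasurable, ?_⟩
    have h := (hind.comp (fun _ s => √(n : ℝ) * s) fun _ => by fun_prop).map_fun_eq_pi_map
      fun p : Fin n × Fin d => (hlaw p.1 p.2).aemeasurable
    refine h.trans ?_
    congr 1
    funext p
    exact (hlaw p.1 p.2).map_eq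
  rcases hA with ⟨hind, hlaw⟩ | ⟨hind, hlaw⟩
  · refine ⟨_, Or.inl rfl, hjoint _ hind fun i j => ?_⟩
    convert gaussianReal_const_mul (hlaw i j) √(n : ℝ) using 2
    · simp
    · ext
      simp [hn'.ne']
  · refine ⟨_, Or.inr rfl, hjoint _ hind fun i j => ?_⟩
    refine ⟨(hlaw i j).aemeasurable.const_mul _, ?_⟩
    have hm : Measurable fun s : ℝ => √(n : ℝ) * s := by fun_prop
    have h := AEMeasurable.map_map_of_aemeasurable (μ := P) hm.aemeasurable (hlaw i j).aemeasurable
    rw [(hlaw i j).map_eq] at h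
    refine h.symm.trans ?_
    have hs : √(n : ℝ) ≠ 0 := (Real.sqrt_pos.2 hn').ne'
    rw [Measure.map_add _ _ hm, Measure.map_smul, Measure.map_smul, Measure.map_dirac' hm,
      Measure.map_dirac' hm, rademacher, mul_neg, mul_one_div_cancel hs]

end Deviation

/-! ### The union bound -/

lemma dotProduct_self_eq_l2norm_sq {m : ℕ} (v : Fin m → ℝ) : v ⬝ᵥ v = l2norm v ^ 2 := by
  rw [l2norm, EuclideanSpace.real_norm_sq_eq]
  exact Finset.sum_congr rfl fun i _ => (sq _).symm

lemma abs_dotProduct_le {m : ℕ} (v w : Fin m → ℝ) : |v ⬝ᵥ w| ≤ l2norm v * l2norm w := by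
  have := abs_real_inner_le_norm (WithLp.toLp 2 w) (WithLp.toLp 2 v)
  rw [EuclideanSpace.inner_eq_star_dotProduct] at this
  simpa [l2norm, mul_comm] using this

lemma HasMargin.lt_one {d K : ℕ} {Ψ : Matrix (Fin d) (Fin K) ℝ} (hΨ : IsDictionary Ψ)
    {y : Fin d → ℝ} (hy : l2norm y = 1) {Λ : Finset (Fin K)} {ε : ℝ} (hε : 0 < ε)
    (h : HasMargin Ψ y Λ ε) : 0 < K ∧ ε < 1 := by
  have h0 : 0 ≤ ⨆ k : {k // k ∉ Λ}, |y ⬝ᵥ Ψ.col k| := Real.iSup_nonneg fun _ => abs_nonneg _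
  unfold HasMargin at h
  rcases isEmpty_or_nonempty {i // i ∈ Λ} with he | ⟨⟨i⟩⟩
  · rw [Real.iInf_of_isEmpty] at h
    linarith
  · have h1 := ciInf_le (f := fun i : {i // i ∈ Λ} => |y ⬝ᵥ Ψ.col i|)
      (Set.finite_range _).bddBelow i
    have h2 := abs_dotProduct_le y (Ψ.col i)
    have h3 := hΨ i
    rw [hy, one_mul] at h2
    exact ⟨i.1.pos, by linarith⟩

/-- The union bound over the `2 * K` one-sided deviations. -/
lemma one_sub_le_measureReal_recovers {d K n : ℕ} {Ψ : Matrix (Fin d) (Fin K) ℝ}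
    (hΨ : IsDictionary Ψ) {x : Fin K → ℝ} (hy : l2norm (Ψ *ᵥ x) = 1) {ε : ℝ} (hε : 0 < ε)
    (hmargin : HasMargin Ψ (Ψ *ᵥ x) (supp x) ε)
    {Ω : Type*} [MeasurableSpace Ω] (P : Measure Ω) [IsProbabilityMeasure P]
    {A : Ω → Matrix (Fin n) (Fin d) ℝ} (hn : 0 < n)
    (hA : IsGaussianEnsemble P A ∨ IsBernoulliEnsemble P A) :
    1 - 2 * K * Real.exp (-(n * rate ε)) ≤ P.real {ω | Recovers (A ω) Ψ x} := by
  obtain ⟨ν, hν, hlaw⟩ := exists_hasLaw_of_ensemble hn hA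
  have hε1 : ε ≤ 1 := (hmargin.lt_one hΨ hy hε).2.le
  set y := Ψ *ᵥ x
  have hyy : y ⬝ᵥ y = 1 := by rw [dotProduct_self_eq_l2norm_sq, hy, one_pow]
  let w : Fin K → Fin d → ℝ := fun k => Ψ.col k - (y ⬝ᵥ Ψ.col k) • y
  have hyw : ∀ k, y ⬝ᵥ w k = 0 := fun k => by
    simp only [w, dotProduct_sub, dotProduct_smul, hyy, smul_eq_mul]
    ring
  have hww : ∀ k, w k ⬝ᵥ w k ≤ 1 := fun k => by
    have h1 : Ψ.col k ⬝ᵥ Ψ.col k ≤ 1 := by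
      rw [dotProduct_self_eq_l2norm_sq]
      exact pow_le_one₀ (norm_nonneg _) (hΨ k)
    have h2 : w k ⬝ᵥ w k = Ψ.col k ⬝ᵥ Ψ.col k - (y ⬝ᵥ Ψ.col k) ^ 2 := by
      simp only [w, sub_dotProduct, dotProduct_sub, dotProduct_smul, smul_dotProduct, hyy,
        smul_eq_mul, dotProduct_comm (Ψ.col k) y]
      ring
    rw [h2]
    linarith [sq_nonneg (y ⬝ᵥ Ψ.col k)]
  let bad : (Fin d → ℝ) → Set Ω := fun v =>
    {ω | ε / 2 * ((A ω *ᵥ y) ⬝ᵥ (A ω *ᵥ y)) ≤ (A ω *ᵥ y) ⬝ᵥ (A ω *ᵥ v)}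
  have hbad : ∀ v, y ⬝ᵥ v = 0 → v ⬝ᵥ v ≤ 1 → P.real (bad v) ≤ Real.exp (-(n * rate ε)) :=
    fun v h1 h2 => ENNReal.toReal_le_of_le_ofReal (Real.exp_pos _).le
      (measure_deviation_le hn hν hlaw hyy h1 h2 hε hε1)
  have hcover : (Set.univ : Set Ω) ⊆
      {ω | Recovers (A ω) Ψ x} ∪ ⋃ k, (bad (w k) ∪ bad (-w k)) := by
    intro ω _
    by_contra hω
    simp only [Set.mem_union, Set.mem_iUnion, not_or, not_exists, bad, Set.mem_ofPred_eq,
      not_le, Matrix.mulVec_neg, dotProduct_neg] at hω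
    exact hω.1 (recovers_of_deviation_lt _ _ _ hmargin fun k =>
      abs_lt.2 ⟨by linarith [(hω.2 k).2], (hω.2 k).1⟩)
  have hunion : P.real (⋃ k, (bad (w k) ∪ bad (-w k))) ≤ 2 * K * Real.exp (-(n * rate ε)) := by
    calc P.real (⋃ k, (bad (w k) ∪ bad (-w k)))
        ≤ ∑ k, P.real (bad (w k) ∪ bad (-w k)) := measureReal_iUnion_fintype_le _
      _ ≤ ∑ _k : Fin K, 2 * Real.exp (-(n * rate ε)) := by
          refine Finset.sum_le_sum fun k _ => (measureReal_union_le _ _).trans ?_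
          have h1 := hbad (w k) (hyw k) (hww k)
          have h2 := hbad (-w k) (by rw [dotProduct_neg, hyw, neg_zero])
            (by rw [neg_dotProduct_neg]; exact hww k)
          linarith
      _ = 2 * K * Real.exp (-(n * rate ε)) := by
          rw [Finset.sum_const, Finset.card_univ, Fintype.card_fin, nsmul_eq_mul]
          ring
  have h1 : (1 : ℝ) = P.real Set.univ := by simp
  have h2 := (measureReal_mono (μ := P) hcover).trans (measureReal_union_le _ _)
  linarith

end Thresholding

theorem mainTheorem2 {d K n : ℕ} (Ψ : Matrix (Fin d) (Fin K) ℝ)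
    (hΨ : Thresholding.IsDictionary Ψ) (x : Fin K → ℝ)
    (hy : Thresholding.l2norm (Ψ *ᵥ x) = 1) (ε : ℝ) (hε : 0 < ε)
    (hmargin : Thresholding.HasMargin Ψ (Ψ *ᵥ x) (Thresholding.supp x) ε)
    {Ω : Type*} [MeasurableSpace Ω] (P : Measure Ω) [IsProbabilityMeasure P]
    (A : Ω → Matrix (Fin n) (Fin d) ℝ)
    (hA : Thresholding.IsGaussianEnsemble P A ∨ Thresholding.IsBernoulliEnsemble P A) (t : ℝ) :
    (Thresholding.C ε * (Real.log (2 * (K : ℝ)) + t) ≤ (n : ℝ) →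
      1 - Real.exp (-t) < P.real {ω | Thresholding.Recovers (A ω) Ψ x}) ∧
    Thresholding.C ε ≤ (4 * Thresholding.C₁ + 2 * Thresholding.C₂) / ε ^ 2 ∧
    4 * Thresholding.C₁ + 2 * Thresholding.C₂ ≤ 17.71 := by
  open Thresholding in
  obtain ⟨hK, hε1⟩ := hmargin.lt_one hΨ hy hε
  have hK1 : (1 : ℝ) ≤ K := by exact_mod_cast hK
  refine ⟨fun hn => ?_, C_le hε hε1.le, ?_⟩
  · have hC := C_pos hε
    rcases le_or_gt (Real.log (2 * (K : ℝ)) + t) 0 with h0 | h0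
    · -- here `t < 0`, so that the lower bound for the probability is negative
      have hlog : 0 < Real.log (2 * (K : ℝ)) := Real.log_pos (by linarith)
      have : 1 < Real.exp (-t) := Real.one_lt_exp_iff.2 (by linarith)
      linarith [measureReal_nonneg (μ := P) (s := {ω | Recovers (A ω) Ψ x})]
    · have hn0 : (0 : ℝ) < n := (mul_pos hC h0).trans_le hn
      refine lt_of_lt_of_le ?_ (one_sub_le_measureReal_recovers hΨ hy hε hmargin P
        (by exact_mod_cast hn0) hA)
      have hrate := one_lt_C_mul_rate hε hε1.le
      have hlt : Real.log (2 * (K : ℝ)) + t < n * rate ε := by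
        have hr : 0 < rate ε := pos_of_mul_pos_right (one_pos.trans hrate) hC.le
        nlinarith [mul_le_mul_of_nonneg_right hn hr.le, mul_lt_mul_of_pos_left hrate h0]
      have hexp : 2 * (K : ℝ) * Real.exp (-(n * rate ε)) < Real.exp (-t) := by
        conv_lhs => rw [← Real.exp_log (show (0 : ℝ) < 2 * K by linarith), ← Real.exp_add]
        exact Real.exp_lt_exp.2 (by linarith)
      linarith
  · linarith [four_mul_C₁_bounds.2, two_mul_C₂_bounds.2]
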